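/- Let $\kappa$ be an uncountable cardinal. An indexed family $X=\langle u_\eta:\eta\in\kappa\rangle$ of ultrafilters on $\kappa$ is called $\kappa$-discrete if there is a partition $\{U_\eta:\eta\in\kappa\}$ of $\kappa$ into sets of cardinality $\kappa$ such that $U_\eta\in u_\eta$ for all $\eta$. For such $X$ and an ultrafilter $u$ on $\kappa$ let $\sum(X,u)$ be the value at $u$ of the continuous extension $\beta\kappa\to\beta\kappa$ of the map $\eta\mapsto u_\eta$; thus $A\in\sum(X,u)$ iff $\{\eta: A\in u_\eta\}\in u$. The Rudin–Frolík order on $\beta\kappa$ is defined by $u\sqsubseteq v$ iff $v=\sum(X,u)$ for some $\kappa$-discrete $X$; write $u\sqsubset v$ if $u\sqsubseteq v$ and $v\not\sqsubseteq u$. For an ordinal $\alpha$, a matrix $\langle\mathcal F_{\beta,\eta}:(\beta,\eta)\in\alpha\times\kappa\rangle$ of (proper) filters on $\kappa$ is called stratified if (i) there are $F_{\beta,\eta}\in\mathcal F_{\beta,\eta}$ such that for every $\beta<\alpha$ the family $\langle F_{\beta,\eta}:\eta\in\kappa\rangle$ is pairwise disjoint, and (ii) whenever $\beta<\delta<\alpha$,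 $\eta\in\kappa$ and $F\in\mathcal F_{\beta,\eta}$, the set $\{\zeta\in\kappa:F\in\mathcal F_{\delta,\zeta}\}$ has cardinality $\kappa$. Then there is a chain of length $(2^\kappa)^+$ in the Rudin–Frolík order on $\beta\kappa$, that is, a sequence $\langle c_\alpha:\alpha<(2^\kappa)^+\rangle$ of ultrafilters on $\kappa$ with $c_\delta\sqsubset c_\alpha$ whenever $\delta<\alpha<(2^\kappa)^+$. Moreover, there is a triangular array $\langle \mathfrak U_{\alpha,\beta}:\beta<\alpha<(2^\kappa)^+\rangle$ of $\kappa$-discrete families $\mathfrak U_{\alpha,\beta}=\langle u(\alpha,\beta,\eta):\eta\in\kappa\rangle$ of uniform ultrafilters on $\kappa$ (all members have cardinality $\kappa$) such that for every $\alpha<(2^\kappa)^+$: 1. the row $\langle u(\alpha,\beta,\eta):(\beta,\eta)\in\alpha\times\kappa\rangle$ is stratified; 2. $u(\alpha,\beta,\eta)=\sum\bigl(\mathfrak U_{\alpha,\delta},u(\delta,\beta,\eta)\bigr)$ whenever $\beta<\delta<\alpha$ and $\eta\in\kappa$; 3. $u(\delta,\beta,\eta)\sqsubset u(\alpha,\beta,\eta)$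 whenever $\beta<\delta<\alpha$ and $\eta\in\kappa$; so for each fixed $(\beta,\eta)$ the sequence $\langle u(\alpha,\beta,\eta):\beta<\alpha<(2^\kappa)^+\rangle$ is strictly $\sqsubset$-increasing. -/

import Mathlib

open Cardinal Topology

universe u

namespace RudinFrolik

/-- An indexed family `X` of ultrafilters on `K` (indexed by `K` itself) is `κ`-discrete, with
`κ = #K`, if there is a partition `U` of `K` into sets of cardinality `κ` with `U a ∈ X a`. -/
def IsDiscreteFamily {K : Type u} (X : K → Ultrafilter K) : Prop :=
  ∃ U : K → Set K,
    (∀ a b, a ≠ b → Disjoint (U a) (U b)) ∧ (⋃ a, U a) = Set.univ ∧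
      (∀ a, #(U a) = #K) ∧ ∀ a, U a ∈ X a

/-- Frolík's sum `Σ(X, v)`: the value at `v ∈ βK` of the continuous extension
`βK → βK` of the map `a ↦ X a`. -/
noncomputable def frolikSum {K : Type u} (X : K → Ultrafilter K) (v : Ultrafilter K) :
    Ultrafilter K :=
  Ultrafilter.extend X v

/-- A set is in `Σ(X, v)` iff it belongs to `X a` for `v`-almost all `a`. -/
theorem mem_frolikSum {K : Type u} (X : K → Ultrafilter K) (v : Ultrafilter K) (A : Set K) :
    A ∈ frolikSum X v ↔ {a | A ∈ X a} ∈ v := by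
  have h : frolikSum X v = joinM (v.map X) :=
    ultrafilter_extend_eq_iff.2 (ultrafilter_converges_iff.2 rfl)
  rw [h]
  exact Iff.rfl

/-- The Rudin–Frolík (pre)order on `βK`: `v ⊑ w` iff `w = Σ(X, v)` for some
`κ`-discrete family `X`. -/
def RFLe {K : Type u} (v w : Ultrafilter K) : Prop :=
  ∃ X : K → Ultrafilter K, IsDiscreteFamily X ∧ w = frolikSum X v

/-- The strict Rudin–Frolík order. As `⊑` is a partial order of types of ultrafilters,
this says that `v ⊑ w` and that `v` and `w` have different types. -/
def RFLt {K : Type u} (v w : Ultrafilter K) : Prop :=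
  RFLe v w ∧ ¬ RFLe w v

/-- `v` is uniform: all its members have cardinality `#K`. -/
def IsUniform {K : Type u} (v : Ultrafilter K) : Prop :=
  ∀ A ∈ v, #A = #K

/-- `⟨F β η : (β, η) ∈ α × K⟩` is a stratified set of filters on `K`. Only the values `F β η`
with `β < α` matter. -/
def IsStratified {K : Type u} (α : Ordinal.{u}) (F : Ordinal.{u} → K → Filter K) : Prop :=
  (∀ β < α, ∀ η, (F β η).NeBot) ∧
  (∃ S : Ordinal.{u} → K → Set K,
    (∀ β < α, ∀ η, S β η ∈ F β η) ∧
      ∀ β < α, ∀ η ζ, η ≠ ζ → Disjoint (S β η) (S β ζ)) ∧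
  ∀ β δ, β < δ → δ < α → ∀ η, ∀ A ∈ F β η, #{ζ : K | A ∈ F δ ζ} = #K

end RudinFrolik

/-!
Write `κ = #K`. For `δ < α` the family `w α δ` is the same thing as the Boolean
homomorphism `A ↦ {η | A ∈ w α δ η}` of `P(K)` into itself, and the equation
`w α β η = Σ(w α δ, w δ β η)` says that these homomorphisms compose. So the array is built by
recursion on `α`: the rows below `α` form an inverse system of copies of `P(K)`, and row `α` is a
homomorphism from `P(K)` to its inverse limit.

Such homomorphisms exist at every stage, limit or not, because the inverse limit of complete Boolean
algebras is complete (`exists_coherent_between`), so that partial homomorphisms into it extend as in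
Sikorski's theorem. In terms of filters this is `exists_ultrafilter_family_le`: every family of proper
filters which is coherent in one direction extends to a coherent family of ultrafilters.

To make row `α` discrete, fix beforehand functions `f α δ : K → K` for `δ < α`, independent in the
sense that finitely many of them take any prescribed values simultaneously at `κ` points; as `α < (2 ^ κ)⁺`
has at most `2 ^ κ` elements, the Engelking–Karłowicz theorem (`exists_independent_functions`) provides
them. Put `f α α = id`, and demand that `f α δ` equals `f β δ η` almost everywhere for `w α β η`,
whenever `δ ≤ β < α`. For `δ = β` this says that the fibres of `f α β` witness discreteness of `w α β`;
by induction, these demands are coherent, and by independence they are compatible with each other and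
with uniformity (`exists_isRow`).

Stratification then follows from coherence and uniformity (`IsRow.isStratified`). Strictness holds for
sums over any discrete family of uniform ultrafilters (`rfLt_frolikSum`), and rests on the fact that a
map fixing an ultrafilter is the identity almost everywhere (`eventually_eq_id_of_map_eq`).
-/

namespace RudinFrolik

/-! ### Extending coherent families of filters -/

section Extension

variable {ι : Type*} [LinearOrder ι] {K : Type u} {w : ι → ι → K → Ultrafilter K}

/-- `w δ β η` is the array `u(δ, β, η)`, `β < δ`. Then `B ↦ {η | B ∈ w δ β η}` are Boolean
homomorphisms `P(K) → P(K)` which form an inverse system by `hw`. The sequences `q` of the conclusion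
are the elements of its inverse limit; the lemma says that this limit is complete enough to contain
an element between any lower bound `a` and any upper bound `b`. -/
theorem exists_coherent_between
    (hw : ∀ β δ γ, β < δ → δ < γ → ∀ η, w γ β η = frolikSum (w γ δ) (w δ β η))
    (a b : ι → Set K) (hab : ∀ β, a β ⊆ b β)
    (ha : ∀ β δ, β < δ → ∀ η ∈ a β, a δ ∈ w δ β η)
    (hb : ∀ β δ, β < δ → ∀ η, b δ ∈ w δ β η → η ∈ b β) :
    ∃ q : ι → Set K, (∀ β, a β ⊆ q β) ∧ (∀ β, q β ⊆ b β) ∧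
      ∀ β δ, β < δ → ∀ η, η ∈ q β ↔ q δ ∈ w δ β η := by
  let Q : Set (ι → Set K) :=
    {r | (∀ β, a β ⊆ r β) ∧ ∀ β δ, β < δ → ∀ η, r δ ∈ w δ β η → η ∈ r β}
  let q : ι → Set K := fun β => {η | ∀ r ∈ Q, η ∈ r β}
  have hq_le : ∀ r ∈ Q, ∀ β, q β ⊆ r β := fun r hr β η hη => hη r hr
  have haq : ∀ β, a β ⊆ q β := fun β η hη r hr => hr.1 β hη
  have hq : ∀ β δ, β < δ → ∀ η, q δ ∈ w δ β η → η ∈ q β := fun β δ h η hη r hr =>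
    hr.2 β δ h η (Filter.mem_of_superset hη (hq_le r hr δ))
  refine ⟨q, haq, hq_le b ⟨hab, hb⟩, fun β δ hβδ η => ⟨fun hη => ?_, hq β δ hβδ η⟩⟩
  -- Shrinking `q` to its coherent part gives a member of `Q`, so `q` is coherent by minimality.
  let r : ι → Set K := fun β => {η | η ∈ q β ∧ ∀ δ, β < δ → q δ ∈ w δ β η}
  have hr : r ∈ Q := by
    refine ⟨fun β η hη => ⟨haq β hη, fun δ h =>
      Filter.mem_of_superset (ha β δ h η hη) (haq δ)⟩, fun β γ h η hη => ?_⟩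
    have hqγ : q γ ∈ w γ β η := Filter.mem_of_superset hη fun ζ hζ => hζ.1
    refine ⟨hq β γ h η hqγ, fun δ h' => ?_⟩
    rcases lt_trichotomy δ γ with hlt | rfl | hlt
    · rw [hw β δ γ h' hlt, mem_frolikSum] at hqγ
      exact Filter.mem_of_superset hqγ fun ζ hζ => hq δ γ hlt ζ hζ
    · exact hqγ
    · rw [hw β γ δ h hlt, mem_frolikSum]
      exact Filter.mem_of_superset hη fun ζ hζ => hζ.2 δ hlt
  exact (hq_le r hr β hη).2 δ hβδ

/-- A family of proper filters that is coherent in one direction extends to ultrafilters which are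
sums of each other along the given array `w`. -/
theorem exists_ultrafilter_family_le
    (hw : ∀ β δ γ, β < δ → δ < γ → ∀ η, w γ β η = frolikSum (w γ δ) (w δ β η))
    (F₀ : ι → K → Filter K) (hne : ∀ β η, (F₀ β η).NeBot)
    (hF₀ : ∀ β δ, β < δ → ∀ η, ∀ A ∈ F₀ β η, {ζ | A ∈ F₀ δ ζ} ∈ w δ β η) :
    ∃ v : ι → K → Ultrafilter K, (∀ β η, (v β η : Filter K) ≤ F₀ β η) ∧
      ∀ β δ, β < δ → ∀ η, v β η = frolikSum (v δ) (w δ β η) := by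
  classical
  let S : Set (ι → K → Filter K)ᵒᵈ := {F | (∀ β η, (F.ofDual β η).NeBot) ∧
    ∀ β δ, β < δ → ∀ η, ∀ A ∈ F.ofDual β η, {ζ | A ∈ F.ofDual δ ζ} ∈ w δ β η}
  obtain ⟨F, hF₀F, ⟨hFne, hF⟩, hmax⟩ := zorn_le_nonempty₀ S (by
    intro c hc hchain y hy
    let G : ι → K → Filter K := fun β η => ⨅ F : c, F.1.ofDual β η
    have : Nonempty c := ⟨⟨y, hy⟩⟩
    have hdir : ∀ β η, Directed (· ≥ ·) fun F : c => F.1.ofDual β η := by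
      intro β η F F'
      rcases hchain.total F.2 F'.2 with h | h
      · exact ⟨F', h β η, le_rfl⟩
      · exact ⟨F, le_rfl, h β η⟩
    have hmem : ∀ β η A, A ∈ G β η ↔ ∃ F : c, A ∈ F.1.ofDual β η := fun β η A =>
      Filter.mem_iInf_of_directed (hdir β η) A
    refine ⟨OrderDual.toDual G, ⟨fun β η => ?_, fun β δ h η A hA => ?_⟩, fun F hF => ?_⟩
    · exact Filter.iInf_neBot_of_directed' (hdir β η) fun F => (hc F.2).1 β η
    · obtain ⟨F, hA⟩ := (hmem β η A).1 hA
      exact Filter.mem_of_superset ((hc F.2).2 β δ h η A hA) fun ζ hζ =>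
        (hmem δ ζ A).2 ⟨F, hζ⟩
    · exact fun β η => iInf_le (fun F : c => F.1.ofDual β η) ⟨F, hF⟩)
    (OrderDual.toDual F₀) ⟨hne, hF₀⟩
  let F' : ι → K → Filter K := F.ofDual
  have hdec : ∀ A β η, A ∈ F' β η ∨ Aᶜ ∈ F' β η := by
    intro A
    obtain ⟨q, haq, hqb, hq⟩ := exists_coherent_between hw
      (fun β => {η | A ∈ F' β η}) (fun β => {η | Aᶜ ∉ F' β η})
      (fun β η (h : A ∈ F' β η) h' => (hFne β η).ne
        (Filter.empty_mem_iff_bot.1 (by simpa using Filter.inter_mem h h')))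
      (fun β δ h η hη => hF β δ h η A hη)
      (fun β δ h η hη hc => by
        have := Filter.inter_mem hη (hF β δ h η _ hc)
        obtain ⟨ζ, h1, h2⟩ := Filter.nonempty_of_mem this
        exact h1 h2)
    -- The sequence `q` prescribes where to add `A` and where to add `Aᶜ`.
    let B : ι → K → Set K := fun β η => if η ∈ q β then A else Aᶜ
    let G : ι → K → Filter K := fun β η => F' β η ⊓ Filter.principal (B β η)
    have hG : OrderDual.toDual G ∈ S := by
      refine ⟨fun β η => ?_, fun β δ h η C hC => ?_⟩
      · refine Filter.neBot_iff.2 fun hbot => ?_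
        have hB : (B β η)ᶜ ∈ F' β η := by
          have := Filter.mem_inf_principal.1 (Filter.empty_mem_iff_bot.2 hbot)
          exact Filter.mem_of_superset this fun x hx hx' => hx hx'
        by_cases hη : η ∈ q β
        · simp only [B, if_pos hη] at hB
          exact hqb β hη hB
        · simp only [B, if_neg hη, compl_compl] at hB
          exact hη (haq β hB)
      · have h1 := hF β δ h η _ (Filter.mem_inf_principal.1 hC)
        have h2 : {ζ | B δ ζ = B β η} ∈ w δ β η := by
          by_cases hη : η ∈ q β
          · refine Filter.mem_of_superset ((hq β δ h η).1 hη) fun ζ hζ => ?_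
            simp only [B, Set.mem_ofPred_eq, if_pos hη, if_pos hζ]
          · have := Ultrafilter.compl_mem_iff_notMem.2 (fun hh => hη ((hq β δ h η).2 hh))
            refine Filter.mem_of_superset this fun ζ hζ => ?_
            simp only [B, Set.mem_ofPred_eq, if_neg hη, if_neg hζ]
        refine Filter.mem_of_superset (Filter.inter_mem h1 h2) fun ζ hζ => ?_
        refine Filter.mem_inf_principal.2 ?_
        rw [show B δ ζ = B β η from hζ.2]
        exact hζ.1
    have hle : G ≥ F' := hmax hG (fun β η => inf_le_left)
    intro β η
    have hB : B β η ∈ F' β η :=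
      hle β η (Filter.mem_inf_of_right (Filter.mem_principal_self _))
    by_cases hη : η ∈ q β
    · left
      simpa only [B, if_pos hη] using hB
    · right
      simpa only [B, if_neg hη] using hB
  let v : ι → K → Ultrafilter K := fun β η => Ultrafilter.ofComplNotMemIff (F' β η) fun A => by
    refine ⟨fun h => (hdec A β η).resolve_right h, fun h h' => (hFne β η).ne
      (Filter.empty_mem_iff_bot.1 (by simpa using Filter.inter_mem h h'))⟩
  refine ⟨v, fun β η => hF₀F β η, fun β δ h η => ?_⟩
  refine (Ultrafilter.coe_le_coe.1 fun A hA => ?_).symm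
  exact (mem_frolikSum _ _ _).2 (hF β δ h η A hA)

end Extension

/-! ### Independent functions -/

/-- The Engelking–Karłowicz theorem: there are `2 ^ κ` functions `κ → κ` such that any finitely many
of them take any prescribed values simultaneously at `κ` points. -/
theorem exists_independent_functions (K : Type u) [Infinite K] :
    ∃ G : Set K → K → K, ∀ (s : Finset (Set K)) (φ : Set K → K),
      #{x | ∀ A ∈ s, G A x = φ A} = #K := by
  classical
  -- A point codes a finite set `a` together with a finite relation between subsets of `a` and
  -- values; the first coordinate only serves to repeat every code `κ` times.
  have hcard : #(K × Finset K × Finset (Finset K × K)) = #K := by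
    have h : ℵ₀ ≤ #K := aleph0_le_mk K
    simp [mk_finset_of_infinite, mul_eq_self h]
  obtain ⟨e⟩ := Cardinal.eq.1 hcard
  let k₀ : K := Classical.arbitrary K
  let val : Set K → Finset K × Finset (Finset K × K) → K := fun A t =>
    if h : ∃ k, (t.1.filter (· ∈ A), k) ∈ t.2 then h.choose else k₀
  refine ⟨fun A x => val A (e.symm x).2, fun s φ => ?_⟩
  have hsep : ∃ a : Finset K, ∀ A ∈ s, ∀ B ∈ s,
      a.filter (· ∈ A) = a.filter (· ∈ B) → A = B := by
    let d : Set K × Set K → K := fun p =>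
      if h : ∃ x, ¬ (x ∈ p.1 ↔ x ∈ p.2) then h.choose else k₀
    refine ⟨(s ×ˢ s).image d, fun A hA B hB h => ?_⟩
    by_contra hne
    have hex : ∃ x, ¬ (x ∈ A ↔ x ∈ B) := by
      by_contra hall
      push Not at hall
      exact hne (Set.ext hall)
    have hd : d (A, B) ∈ (s ×ˢ s).image d :=
      Finset.mem_image_of_mem d (Finset.mk_mem_product hA hB)
    have hdAB : ¬ (d (A, B) ∈ A ↔ d (A, B) ∈ B) := by
      simp only [d, dif_pos hex]
      exact hex.choose_spec
    apply hdAB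
    have := Finset.ext_iff.1 h (d (A, B))
    simpa only [Finset.mem_filter, hd, true_and] using this
  obtain ⟨a, ha⟩ := hsep
  let t : Finset K × Finset (Finset K × K) := (a, s.image fun A => (a.filter (· ∈ A), φ A))
  have hval : ∀ A ∈ s, val A t = φ A := by
    intro A hA
    have hex : ∃ k, (t.1.filter (· ∈ A), k) ∈ t.2 :=
      ⟨φ A, Finset.mem_image_of_mem _ hA⟩
    simp only [val, dif_pos hex]
    obtain ⟨B, hB, hBe⟩ := Finset.mem_image.1 hex.choose_spec
    rw [Prod.ext_iff] at hBe
    have hBA : B = A := ha B hB A hA hBe.1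
    exact hBe.2.symm.trans (congrArg φ hBA)
  refine le_antisymm (mk_set_le _) ?_
  have hinj : Function.Injective fun k : K =>
      (⟨e (k, t), fun A hA => by simpa using hval A hA⟩ :
        {x | ∀ A ∈ s, val A (e.symm x).2 = φ A}) := by
    intro k k' h
    simpa using h
  exact mk_le_of_injective hinj

/-! ### Fixed points of maps of ultrafilters and strictness of the order -/

/-- Finite case of a two-colouring: on a finite set, a map that increases strictly admits a colouring
with `c (f x) ≠ c x`, as its least element is not a value of `f` and can be coloured last. -/
theorem exists_coloring_finset {K : Type*} [LinearOrder K] (f : K → K) (s : Finset K) :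
    (∀ x ∈ s, x < f x) → ∃ c : K → Bool, ∀ x ∈ s, c (f x) ≠ c x := by
  classical
  induction s using Finset.induction_on_min with
  | empty => exact fun _ => ⟨fun _ => true, by simp⟩
  | insert m s hm ih =>
    intro h
    obtain ⟨c, hc⟩ := ih fun x hx => h x (Finset.mem_insert_of_mem hx)
    have hfm : f m ≠ m := (h m (Finset.mem_insert_self m s)).ne'
    refine ⟨Function.update c m (!c (f m)), fun x hx => ?_⟩
    rcases Finset.mem_insert.1 hx with rfl | hx'
    · simp [Function.update_of_ne hfm]
    · have hx1 : x ≠ m := (hm x hx').ne'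
      have hx2 : f x ≠ m := ((hm x hx').trans (h x hx)).ne'
      rw [Function.update_of_ne hx1, Function.update_of_ne hx2]
      exact hc x hx'

/-- By compactness, the colourings of finite sets give one of all `x` with `x < f x`; one of its
colour classes belongs to the ultrafilter, and `f` maps it off itself. -/
theorem not_eventually_lt_of_map_eq {K : Type*} [LinearOrder K] {f : K → K} {v : Ultrafilter K}
    (hf : v.map f = v) : ¬ ∀ᶠ x in v, x < f x := by
  classical
  intro hlt
  have hfin : ∀ s : Finset K, ∃ c : K → Bool, ∀ x ∈ s, x < f x → c (f x) ≠ c x := fun s => by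
    obtain ⟨c, hc⟩ := exists_coloring_finset f (s.filter fun x => x < f x) (by simp)
    exact ⟨c, fun x hx h => hc x (Finset.mem_filter.2 ⟨hx, h⟩)⟩
  choose c hc using hfin
  let U : Ultrafilter (Finset K) := Ultrafilter.of Filter.atTop
  let C : Set K := {x | ∀ᶠ s in U, c s x = true}
  have hC : ∀ x, x < f x → (f x ∈ C ↔ x ∉ C) := by
    intro x hx
    have hxs : ∀ᶠ s : Finset K in U, x ∈ s :=
      Ultrafilter.of_le Filter.atTop (Filter.eventually_ge_atTop {x} |>.mono fun s hs => by
        simpa using hs)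
    have : x ∉ C ↔ ∀ᶠ s in U, ¬ c s x = true := Ultrafilter.eventually_not.symm
    rw [this]
    refine Filter.eventually_congr (hxs.mono fun s hs => ?_)
    have := hc s x hs hx
    cases h1 : c s x <;> cases h2 : c s (f x) <;> simp_all
  have h1 : C ∈ v ↔ f ⁻¹' C ∈ v := by
    conv_lhs => rw [← hf]
    exact Ultrafilter.mem_map
  have h2 : f ⁻¹' C ∈ v ↔ Cᶜ ∈ v := Filter.eventually_congr (hlt.mono fun x hx => hC x hx)
  rw [h2, Ultrafilter.compl_mem_iff_notMem] at h1
  tauto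

theorem eventually_eq_id_of_map_eq {K : Type*} {f : K → K} {v : Ultrafilter K}
    (hf : v.map f = v) : ∀ᶠ x in v, f x = x := by
  classical
  let _ : LinearOrder K := linearOrderOfSTO (WellOrderingRel (α := K))
  by_contra h
  rw [← Ultrafilter.eventually_not] at h
  have h' : ∀ᶠ x in v, x < f x ∨ f x < x := h.mono fun x hx => (Ne.lt_or_gt hx).symm
  rcases Ultrafilter.eventually_or.1 h' with h | h
  · exact not_eventually_lt_of_map_eq hf h
  · exact not_eventually_lt_of_map_eq (K := Kᵒᵈ) (f := f) (v := v) hf h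

variable {K : Type u}

/-- The partition witnessing `κ`-discreteness, as a function `p` to the index set, recovers `v` from
`Σ(X, v)`. -/
theorem IsDiscreteFamily.exists_map {X : K → Ultrafilter K} (hX : IsDiscreteFamily X) :
    ∃ p : K → K, (∀ a, p ⁻¹' {a} ∈ X a) ∧ ∀ v, (frolikSum X v).map p = v := by
  obtain ⟨U, hdisj, hcov, -, hU⟩ := hX
  have hex : ∀ x, ∃ a, x ∈ U a := fun x => Set.mem_iUnion.1 (hcov ▸ Set.mem_univ x)
  choose p hp using hex
  have hpU : ∀ a, U a ⊆ p ⁻¹' {a} := fun a x hx => by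
    by_contra hne
    exact Set.disjoint_left.1 (hdisj _ _ hne) (hp x) hx
  have hpX : ∀ a, p ⁻¹' {a} ∈ X a := fun a => Filter.mem_of_superset (hU a) (hpU a)
  refine ⟨p, hpX, fun v => ?_⟩
  refine Ultrafilter.coe_le_coe.1 fun A hA => ?_
  rw [Ultrafilter.mem_coe, Ultrafilter.mem_map, mem_frolikSum]
  refine Filter.mem_of_superset hA fun a ha => Filter.mem_of_superset (hpX a) fun x hx => ?_
  rwa [Set.mem_preimage, show p x = a from hx]

theorem IsUniform.exists_ne [Infinite K] {v : Ultrafilter K} (hv : IsUniform v) {A : Set K}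
    (hA : A ∈ v) : ∃ a ∈ A, ∃ b ∈ A, a ≠ b := by
  have h : 1 < #A := by
    rw [hv A hA]
    exact one_lt_aleph0.trans_le (aleph0_le_mk K)
  obtain ⟨a, b, hab⟩ := one_lt_iff_nontrivial.1 h
  exact ⟨a, a.2, b, b.2, fun h => hab (Subtype.ext h)⟩

/-- If also `v = Σ(Y, Σ(X, v))`, the composition of the two partition functions fixes `v`, hence is
the identity on a set `A ∈ v`. Then some `X η` is concentrated on a single point, which uniformity
excludes. -/
theorem rfLt_frolikSum [Infinite K] {X : K → Ultrafilter K} (hX : IsDiscreteFamily X)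
    (hu : ∀ a, IsUniform (X a)) (v : Ultrafilter K) : RFLt v (frolikSum X v) := by
  refine ⟨⟨X, hX, rfl⟩, ?_⟩
  rintro ⟨Y, hY, hv⟩
  obtain ⟨p, hp, hpv⟩ := hX.exists_map
  obtain ⟨r, hr, hrv⟩ := hY.exists_map
  have hfix : v.map (p ∘ r) = v := by
    rw [← Ultrafilter.map_map]
    conv_lhs => rw [hv, hrv, hpv]
  let A : Set K := {x | p (r x) = x}
  have hA : A ∈ v := eventually_eq_id_of_map_eq hfix
  rw [hv, mem_frolikSum, mem_frolikSum] at hA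
  obtain ⟨η, hη⟩ := Ultrafilter.nonempty_of_mem hA
  have hmem : {a | A ∈ Y a} ∩ p ⁻¹' {η} ∈ X η := Filter.inter_mem hη (hp η)
  have key : ∀ a ∈ {a | A ∈ Y a} ∩ p ⁻¹' {η}, r η = a := by
    rintro a ⟨ha, hpa⟩
    obtain ⟨x, hx, hrx⟩ := Ultrafilter.nonempty_of_mem (Filter.inter_mem ha (hr a))
    have hrx : r x = a := hrx
    have hpa : p a = η := hpa
    have hx : p (r x) = x := hx
    rw [hrx, hpa] at hx
    rw [hx, hrx]
  obtain ⟨a, ha, b, hb, hab⟩ := (hu η).exists_ne hmem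
  exact hab ((key a ha).symm.trans (key b hb))

/-! ### The construction of a row -/

/-- Given the functions `G i`, `i ∈ J`, and values `φ i`: the sets which contain, up to fewer than `κ`
points, the set of common solutions of finitely many equations `G i x = φ i`. -/
def cylinderFilter {ι : Type*} {K : Type u} [Infinite K] (G : ι → K → K) (J : Set ι) (φ : ι → K) :
    Filter K where
  sets := {A | ∃ s : Finset ι, ↑s ⊆ J ∧ #{x | (∀ i ∈ s, G i x = φ i) ∧ x ∉ A} < #K}
  univ_sets := ⟨∅, by simp, by simpa using pos_iff_ne_zero.2 (mk_ne_zero K)⟩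
  sets_of_superset := by
    rintro A B ⟨s, hs, hA⟩ hAB
    refine ⟨s, hs, (mk_le_mk_of_subset ?_).trans_lt hA⟩
    exact fun x hx => ⟨hx.1, fun h => hx.2 (hAB h)⟩
  inter_sets := by
    classical
    rintro A B ⟨s, hs, hA⟩ ⟨t, ht, hB⟩
    refine ⟨s ∪ t, by simp [hs, ht], ?_⟩
    refine (mk_le_mk_of_subset ?_).trans_lt
      ((mk_union_le _ _).trans_lt (add_lt_of_lt (aleph0_le_mk K) hA hB))
    rintro x ⟨hx, hxAB⟩
    by_cases hxA : x ∈ A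
    · exact Or.inr ⟨fun i hi => hx i (Finset.mem_union_right s hi), fun h => hxAB ⟨hxA, h⟩⟩
    · exact Or.inl ⟨fun i hi => hx i (Finset.mem_union_left t hi), hxA⟩

section Row

variable {ι : Type*} {K : Type u} [Infinite K] {G : ι → K → K} {J : Set ι} {φ : ι → K}

theorem mem_cylinderFilter {A : Set K} : A ∈ cylinderFilter G J φ ↔
    ∃ s : Finset ι, ↑s ⊆ J ∧ #{x | (∀ i ∈ s, G i x = φ i) ∧ x ∉ A} < #K :=
  Iff.rfl

theorem cylinderFilter_neBot
    (hG : ∀ s : Finset ι, ↑s ⊆ J → #{x | ∀ i ∈ s, G i x = φ i} = #K) :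
    (cylinderFilter G J φ).NeBot := by
  refine Filter.neBot_iff.2 fun h => ?_
  obtain ⟨s, hs, hlt⟩ := mem_cylinderFilter.1 (Filter.empty_mem_iff_bot.2 h)
  simp only [Set.mem_empty_iff_false, not_false_eq_true, and_true] at hlt
  exact hlt.ne (hG s hs)

theorem preimage_mem_cylinderFilter {i : ι} (hi : i ∈ J) :
    {x | G i x = φ i} ∈ cylinderFilter G J φ :=
  ⟨{i}, by simpa using hi, by simpa using pos_iff_ne_zero.2 (mk_ne_zero K)⟩

theorem isUniform_of_le_cylinderFilter {v : Ultrafilter K}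
    (hv : (v : Filter K) ≤ cylinderFilter G J φ) : IsUniform v := by
  intro A hA
  by_contra hne
  refine Ultrafilter.compl_notMem_iff.2 hA (hv ⟨∅, by simp, ?_⟩)
  simpa using (mk_set_le A).lt_of_ne hne

theorem mem_cylinderFilter_of_subset {J' : Set ι} {φ' : ι → K} (hJ : J ⊆ J')
    {A : Set K} {s : Finset ι} (hs : ↑s ⊆ J)
    (hA : #{x | (∀ i ∈ s, G i x = φ i) ∧ x ∉ A} < #K) (hφ : ∀ i ∈ s, φ' i = φ i) :
    A ∈ cylinderFilter G J' φ' := by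
  refine ⟨s, hs.trans hJ, (mk_le_mk_of_subset ?_).trans_lt hA⟩
  rintro x ⟨hx, hxA⟩
  exact ⟨fun i hi => (hx i hi).trans (hφ i hi), hxA⟩

/-- The properties of row `α` of the array that are preserved by the recursion. Here `f α δ` is the
partition function for column `δ` on the copy of `K` that carries row `α`. -/
structure IsRow (f : Ordinal.{u} → Ordinal.{u} → K → K)
    (w : Ordinal.{u} → Ordinal.{u} → K → Ultrafilter K) (α : Ordinal.{u})
    (v : Ordinal.{u} → K → Ultrafilter K) : Prop where
  /-- Coherence with the earlier rows. -/
  eq_sum : ∀ β δ, β < δ → δ < α → ∀ η, v β η = frolikSum (v δ) (w δ β η)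
  /-- Compatibility with the partition functions. -/
  fiber_mem : ∀ δ β, δ ≤ β → β < α → ∀ η, {x | f α δ x = f β δ η} ∈ v β η
  /-- All members of the row are uniform. -/
  uniform : ∀ β < α, ∀ η, IsUniform (v β η)

theorem exists_isRow (f : Ordinal.{u} → Ordinal.{u} → K → K)
    (w : Ordinal.{u} → Ordinal.{u} → K → Ultrafilter K) (α : Ordinal.{u})
    (hf : ∀ (s : Finset Ordinal.{u}) (φ : Ordinal.{u} → K), ↑s ⊆ Set.Iio α →
      #{x | ∀ δ ∈ s, f α δ x = φ δ} = #K)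
    (hw : ∀ δ < α, IsRow f w δ (w δ)) : ∃ v, IsRow f w α v := by
  classical
  let F₀ : Set.Iio α → K → Filter K := fun β η =>
    cylinderFilter (f α) (Set.Iic β.1) fun δ => f β.1 δ η
  obtain ⟨v, hv, hsum⟩ := exists_ultrafilter_family_le (ι := Set.Iio α)
    (w := fun δ β => w δ.1 β.1)
    (fun β δ γ h h' η => (hw γ.1 γ.2).eq_sum β δ h h' η) F₀
    (fun β η => cylinderFilter_neBot fun s hs =>
      hf s _ fun δ hδ => (show δ ≤ β.1 from hs hδ).trans_lt β.2)
    (by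
      rintro β δ h η A ⟨s, hs, hA⟩
      have hmem : (⋂ i ∈ s, {ζ | f δ.1 i ζ = f β.1 i η}) ∈ w δ.1 β.1 η :=
        (Filter.biInter_finset_mem s).2 fun i hi =>
          (hw δ.1 δ.2).fiber_mem i β.1 (hs hi) h η
      refine Filter.mem_of_superset hmem fun ζ hζ => ?_
      exact mem_cylinderFilter_of_subset (G := f α) (φ := fun i => f β.1 i η)
        (Set.Iic_subset_Iic.2 (show β.1 ≤ δ.1 from h.le)) hs hA
        fun i hi => Set.mem_iInter₂.1 hζ i hi)
  refine ⟨fun β η => if h : β < α then v ⟨β, h⟩ η else pure η, ?_, ?_, ?_⟩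
  · intro β δ h h' η
    simp only [dif_pos h', dif_pos (h.trans h')]
    exact hsum ⟨β, h.trans h'⟩ ⟨δ, h'⟩ h η
  · intro δ β h h' η
    simp only [dif_pos h']
    exact hv ⟨β, h'⟩ η (preimage_mem_cylinderFilter (φ := fun δ => f β δ η) h)
  · intro β h η
    simp only [dif_pos h]
    exact isUniform_of_le_cylinderFilter (hv ⟨β, h⟩ η)

end Row

/-! ### The array -/

section Array

variable {K : Type u}

theorem IsRow.congr {f : Ordinal.{u} → Ordinal.{u} → K → K}
    {w w' : Ordinal.{u} → Ordinal.{u} → K → Ultrafilter K} {α : Ordinal.{u}}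
    {v : Ordinal.{u} → K → Ultrafilter K} (h : IsRow f w α v) (hww' : ∀ δ < α, w δ = w' δ) :
    IsRow f w' α v :=
  ⟨fun β δ h1 h2 η => hww' δ h2 ▸ h.eq_sum β δ h1 h2 η, h.fiber_mem, h.uniform⟩

theorem exists_array [Infinite K] (f : Ordinal.{u} → Ordinal.{u} → K → K) (l : Ordinal.{u})
    (hf : ∀ α < l, ∀ (s : Finset Ordinal.{u}) (φ : Ordinal.{u} → K), ↑s ⊆ Set.Iio α →
      #{x | ∀ δ ∈ s, f α δ x = φ δ} = #K) :
    ∃ w : Ordinal.{u} → Ordinal.{u} → K → Ultrafilter K, ∀ α < l, IsRow f w α (w α) := by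
  classical
  let extend : (α : Ordinal.{u}) → ((δ : Ordinal.{u}) → δ < α → Ordinal.{u} → K → Ultrafilter K) →
      Ordinal.{u} → Ordinal.{u} → K → Ultrafilter K :=
    fun α prev δ => if h : δ < α then prev δ h else fun _ η => pure η
  let w : Ordinal.{u} → Ordinal.{u} → K → Ultrafilter K :=
    WellFounded.fix (C := fun _ => Ordinal.{u} → K → Ultrafilter K) Ordinal.lt_wf fun α prev =>
      if h : ∃ v, IsRow f (extend α prev) α v then h.choose else fun _ η => pure η
  refine ⟨w, fun α => ?_⟩
  induction α using WellFoundedLT.induction with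
  | ind α ih =>
    intro hα
    have hext : ∀ δ < α, extend α (fun δ _ => w δ) δ = w δ := fun δ h => by
      simp only [extend, dif_pos h]
    obtain ⟨v, hv⟩ := exists_isRow f w α (hf α hα) fun δ h => ih δ h (h.trans hα)
    have hex : ∃ v, IsRow f (extend α fun δ _ => w δ) α v :=
      ⟨v, hv.congr fun δ h => (hext δ h).symm⟩
    have hwα : w α = hex.choose := by
      rw [show w α = _ from WellFounded.fix_eq _ _ α]
      exact dif_pos hex
    rw [hwα]
    exact hex.choose_spec.congr hext

/-- Independent partition functions for every row: since `α < (2 ^ κ)⁺` has at most `2 ^ κ` elements,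
the functions of an independent family can be distributed to the columns of row `α`. -/
theorem exists_partition_functions (K : Type u) [Infinite K] :
    ∃ f : Ordinal.{u} → Ordinal.{u} → K → K, (∀ α, f α α = id) ∧
      ∀ α < (Order.succ ((2 : Cardinal.{u}) ^ #K)).ord,
        ∀ (s : Finset Ordinal.{u}) (φ : Ordinal.{u} → K), ↑s ⊆ Set.Iio α →
          #{x | ∀ δ ∈ s, f α δ x = φ δ} = #K := by
  classical
  obtain ⟨G, hG⟩ := exists_independent_functions K
  have hinj : ∀ α : Ordinal.{u}, α < (Order.succ ((2 : Cardinal.{u}) ^ #K)).ord →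
      ∃ e : Ordinal.{u} → Set K, Set.InjOn e (Set.Iio α) := by
    intro α hα
    have hcard : α.card ≤ #(Set K) := by
      rw [mk_set]
      exact Order.lt_succ_iff.1 (lt_ord.1 hα)
    have : Cardinal.lift.{u} #(Set.Iio α) ≤ Cardinal.lift.{u + 1} #(Set K) := by
      rw [mk_Iio_ordinal, lift_lift, lift_le]
      exact hcard
    obtain ⟨e⟩ := lift_mk_le'.1 this
    refine ⟨fun δ => if h : δ < α then e ⟨δ, h⟩ else ∅, fun δ hδ δ' hδ' h => ?_⟩
    simp only [dif_pos (show δ < α from hδ), dif_pos (show δ' < α from hδ')] at h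
    simpa using e.injective h
  let e : Ordinal.{u} → Ordinal.{u} → Set K := fun α =>
    if h : ∃ e : Ordinal.{u} → Set K, Set.InjOn e (Set.Iio α) then h.choose else fun _ => ∅
  have he : ∀ α < (Order.succ ((2 : Cardinal.{u}) ^ #K)).ord, Set.InjOn (e α) (Set.Iio α) := by
    intro α hα
    simp only [e, dif_pos (hinj α hα)]
    exact (hinj α hα).choose_spec
  refine ⟨fun α δ => if δ = α then id else G (e α δ), fun α => if_pos rfl, fun α hα s φ hs => ?_⟩
  rw [← hG (s.image (e α)) fun A => φ (Function.invFunOn (e α) (Set.Iio α) A)]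
  congr 2
  ext x
  simp only [Set.mem_ofPred_eq, Finset.forall_mem_image]
  refine forall₂_congr fun δ hδ => ?_
  have hδα : δ ∈ Set.Iio α := hs hδ
  rw [if_neg (ne_of_lt hδα), (he α hα).leftInvOn_invFunOn hδα]

variable {f : Ordinal.{u} → Ordinal.{u} → K → K}
  {w : Ordinal.{u} → Ordinal.{u} → K → Ultrafilter K} {α β : Ordinal.{u}}
  {v : Ordinal.{u} → K → Ultrafilter K}

theorem IsRow.isDiscreteFamily (h : IsRow f w α v) (hid : ∀ α, f α α = id)
    (hf : ∀ (s : Finset Ordinal.{u}) (φ : Ordinal.{u} → K), ↑s ⊆ Set.Iio α →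
      #{x | ∀ δ ∈ s, f α δ x = φ δ} = #K) (hβ : β < α) : IsDiscreteFamily (v β) := by
  refine ⟨fun η => {x | f α β x = η}, fun a b hab => ?_, ?_, fun η => ?_, fun η => ?_⟩
  · exact Set.disjoint_left.2 fun x hxa hxb => hab (hxa.symm.trans hxb)
  · exact Set.iUnion_eq_univ_iff.2 fun x => ⟨f α β x, rfl⟩
  · simpa using hf {β} (fun _ => η) (by simpa using hβ)
  · simpa [hid] using h.fiber_mem β β le_rfl hβ η

/-- Disjointness comes from discreteness; the second clause holds as, by coherence, the set in question
belongs to a uniform ultrafilter. -/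
theorem IsRow.isStratified (h : IsRow f w α v) (hw : ∀ δ < α, IsRow f w δ (w δ))
    (hd : ∀ β < α, IsDiscreteFamily (v β)) :
    IsStratified α fun β η => (v β η : Filter K) := by
  refine ⟨fun β _ η => (v β η).neBot, ?_, fun β δ hβδ hδ η A hA => ?_⟩
  · have hS : ∀ β, ∃ S : K → Set K, β < α →
        (∀ η, S η ∈ v β η) ∧ ∀ η ζ, η ≠ ζ → Disjoint (S η) (S ζ) := by
      intro β
      by_cases hβ : β < α
      · obtain ⟨U, hU, -, -, hUv⟩ := hd β hβ
        exact ⟨U, fun _ => ⟨hUv, hU⟩⟩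
      · exact ⟨fun _ => ∅, fun h => absurd h hβ⟩
    choose S hS using hS
    exact ⟨S, fun β hβ => (hS β hβ).1, fun β hβ => (hS β hβ).2⟩
  · rw [Ultrafilter.mem_coe, h.eq_sum β δ hβδ hδ η, mem_frolikSum] at hA
    exact (hw δ hδ).uniform β hβδ η _ hA

end Array

end RudinFrolik

theorem mainTheorem1 (K : Type u) (hK : ℵ₀ < #K) :
    -- a strictly increasing sequence of length `(2^κ)^+`
    (∃ c : Ordinal.{u} → Ultrafilter K,
      ∀ δ α : Ordinal.{u}, δ < α → α < (Order.succ ((2 : Cardinal.{u}) ^ #K)).ord →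
        RudinFrolik.RFLt (c δ) (c α)) ∧
    -- the triangular array `⟨w α β η : β < α < (2^κ)^+, η ∈ κ⟩`
    (∃ w : Ordinal.{u} → Ordinal.{u} → K → Ultrafilter K,
      ∀ α < (Order.succ ((2 : Cardinal.{u}) ^ #K)).ord,
        (∀ β < α, RudinFrolik.IsDiscreteFamily (w α β)) ∧
        (∀ β < α, ∀ η, RudinFrolik.IsUniform (w α β η)) ∧
        RudinFrolik.IsStratified α (fun β η => (w α β η : Filter K)) ∧
        (∀ β δ, β < δ → δ < α → ∀ η,
          w α β η = RudinFrolik.frolikSum (w α δ) (w δ β η)) ∧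
        (∀ β δ, β < δ → δ < α → ∀ η, RudinFrolik.RFLt (w δ β η) (w α β η))) := by
  have hinf : Infinite K := infinite_iff.2 hK.le
  obtain ⟨f, hid, hf⟩ := RudinFrolik.exists_partition_functions K
  obtain ⟨w, hw⟩ := RudinFrolik.exists_array f _ hf
  have hdisc : ∀ α < (Order.succ ((2 : Cardinal.{u}) ^ #K)).ord, ∀ β < α,
      RudinFrolik.IsDiscreteFamily (w α β) := fun α hα β hβ =>
    (hw α hα).isDiscreteFamily hid (hf α hα) hβ
  have hlt : ∀ α < (Order.succ ((2 : Cardinal.{u}) ^ #K)).ord, ∀ β δ, β < δ → δ < α → ∀ η,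
      RudinFrolik.RFLt (w δ β η) (w α β η) := fun α hα β δ hβδ hδ η => by
    rw [(hw α hα).eq_sum β δ hβδ hδ η]
    exact RudinFrolik.rfLt_frolikSum (hdisc α hα δ hδ) ((hw α hα).uniform δ hδ) _
  refine ⟨?_, w, fun α hα => ⟨hdisc α hα, (hw α hα).uniform, ?_, (hw α hα).eq_sum, hlt α hα⟩⟩
  · -- The column `β = 0` starts at row `1`, so the chain is indexed with a shift by one.
    have hlim : Order.IsSuccLimit (Order.succ ((2 : Cardinal.{u}) ^ #K)).ord :=
      isSuccLimit_ord ((hK.le.trans (cantor _).le).trans (Order.le_succ _))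
    refine ⟨fun α => w (Order.succ α) 0 (Classical.arbitrary K), fun δ α hδα hα => ?_⟩
    exact hlt _ (hlim.succ_lt hα) 0 _ (Order.bot_lt_succ δ) (Order.succ_lt_succ hδα) _
  · exact (hw α hα).isStratified (fun δ hδ => hw δ (hδ.trans hα)) (hdisc α hα)
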